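/- Let $\Sigma$ be a signature (a set of symbols, each with a fixed finite arity), let $\mathcal X$ be a set of variables, and let $T$ be the set of finite and infinite terms over $\Sigma$ and $\mathcal X$ (the final coalgebra of $Y\mapsto \mathcal X+\coprod_{f\in\Sigma}Y^{\mathrm{ar}(f)}$), with the distance $d(s,t)=2^{-n}$ if $n$ is the first level at which $s\neq t$ differ as labelled trees, and $d(s,s)=0$. Let $\mathcal R$ be a term rewriting system, that is, a set of rules $\ell\to r$ with $\ell,r\in T$ (possibly infinite), $\ell\notin\mathcal X$ and $\mathrm{Var}(r)\subseteq\mathrm{Var}(\ell)$. Its root steps are $\to_\varepsilon\;=\{(\ell\sigma,r\sigma)\mid \ell\to r\in\mathcal R,\ \sigma:\mathcal X\to T\}$. For a relation $R\subseteq T\times T$, an $R$-step at position $p$ is a pair $(C[u],C[v])$, where $(u,v)\in R$ and $C$ is a one-hole context with its hole at position $p$; its depth is the length $|p|$. The rewrite relation $\to$ of $\mathcal R$ consists of all $\to_\varepsilon$-steps, at any position. For $R\subseteq T\times T$ let - $E(R)$ be the equivalence relation generated by $R$; - $S(R)$ be the strongly convergent rewrite relation obtained from $R$: $(s,t)\in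 S(R)$ if there are an ordinal $\alpha$ and terms $(t_\beta)_{\beta\le\alpha}$ with $t_0=s$ and $t_\alpha=t$, together with positions $(p_\beta)_{\beta<\alpha}$, such that $(t_\beta,t_{\beta+1})$ is an $R$-step at position $p_\beta$ for every $\beta<\alpha$, and, for every limit ordinal $\lambda\le\alpha$, $d(t_\beta,t_\lambda)\to0$ and $|p_\beta|\to\infty$ as $\beta$ approaches $\lambda$ from below; - $S_E(R)=(S\circ E)^{\star}(R)$ be the least relation $x\subseteq T\times T$ with $R\cup S(E(x))\subseteq x$, i.e. $\mu x.\,R\cup S(E(x))$; - $\overline R=\{(f(s_1,\dots,s_n),f(t_1,\dots,t_n))\mid f\in\Sigma,\ n=\mathrm{ar}(f),\ (s_1,t_1),\dots,(s_n,t_n)\in R\}\cup\mathrm{id}$. Infinitary equational reasoning is the greatest fixed point $${\stackrel{\infty}{=}}\;=\;\nu R.\,(\leftarrow_\varepsilon\cup\to_\varepsilon\cup\;\overline R)^*,$$ where $^*$ denotes the reflexive-transitive closure. **Lemma.** For every term rewriting system $\mathcal R$ we have ${S_E(\to)}\subseteq{\stackrel{\infty}{=}}$. -/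

import Mathlib

universe u v w

/-- A signature: a set of symbols, each with a fixed finite arity. -/
structure Signature where
  Sym : Type u
  arity : Sym → ℕ

namespace InfRew

/-- The type constructor `Y ↦ X + ∐ f, Y ^ arity f`. -/
abbrev termFunctor (S : Signature.{u}) (X : Type v) : PFunctor.{max u v, 0} where
  A := X ⊕ S.Sym
  B := Sum.elim (fun _ => Empty) (fun f => Fin (S.arity f))

/-- Finite and infinite terms over the signature `S` and the variables `X`: the final coalgebra
of the type constructor above, so that equality is bisimilarity. -/
abbrev Term (S : Signature.{u}) (X : Type v) : Type (max u v) :=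
  (termFunctor S X).M

variable {S : Signature.{u}} {X : Type v}

/-- A variable as a term. -/
def Term.var (x : X) : Term S X :=
  PFunctor.M.mk ⟨Sum.inl x, Empty.elim⟩

/-- The term `f(t₁, …, tₙ)`. -/
def Term.app (f : S.Sym) (ts : Fin (S.arity f) → Term S X) : Term S X :=
  PFunctor.M.mk ⟨Sum.inr f, ts⟩

/-- The variable or symbol at the root of a term. -/
def Term.head (t : Term S X) : X ⊕ S.Sym :=
  (PFunctor.M.dest t).1

/-- The subterm of `t` at a position, `none` if this is not a position of `t`.
Positions are words over `ℕ`; arguments are numbered from `0`. -/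
def Term.subtermAt : Term S X → List ℕ → Option (Term S X)
  | t, [] => some t
  | t, i :: p =>
    match PFunctor.M.dest t with
    | ⟨Sum.inl _, _⟩ => none
    | ⟨Sum.inr f, ts⟩ => if h : i < S.arity f then Term.subtermAt (ts ⟨i, h⟩) p else none

/-- The set of variables that occur in a term. -/
def Term.vars (t : Term S X) : Set X :=
  {x | ∃ p, t.subtermAt p = some (Term.var x)}

/-- One layer of the corecursive definition of substitution. A state `Sum.inl t` stands for
`tσ`, a state `Sum.inr t` for `t` itself. -/
def Term.substStep (σ : X → Term S X) :
    Term S X ⊕ Term S X → (termFunctor S X) (Term S X ⊕ Term S X)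
  | Sum.inl t =>
    match PFunctor.M.dest t with
    | ⟨Sum.inl x, _⟩ => (termFunctor S X).map Sum.inr (PFunctor.M.dest (σ x))
    | ⟨Sum.inr f, ts⟩ => ⟨Sum.inr f, fun i => Sum.inl (ts i)⟩
  | Sum.inr t => (termFunctor S X).map Sum.inr (PFunctor.M.dest t)

/-- The application `tσ` of a substitution `σ` to a term `t`. -/
def Term.subst (σ : X → Term S X) (t : Term S X) : Term S X :=
  PFunctor.M.corec (Term.substStep σ) (Sum.inl t)

/-- The terms `s` and `t` have a difference at level `n`, when viewed as labelled trees. -/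
def Term.DiffersAtLevel (s t : Term S X) (n : ℕ) : Prop :=
  ∃ p : List ℕ, p.length = n ∧
    (s.subtermAt p).map Term.head ≠ (t.subtermAt p).map Term.head

open Classical in
/-- The usual distance on terms: `2⁻ⁿ` if `n` is the first level where `s` and `t` differ, and
`0` if `s = t`. -/
noncomputable def Term.dist (s t : Term S X) : ℝ :=
  if s = t then 0 else (2⁻¹ : ℝ) ^ sInf {n | Term.DiffersAtLevel s t n}

/-- Contexts, that is, finite or infinite terms with precisely one occurrence of a hole. As the
hole occurs at a finite position and nowhere else, such a term is the hole itself or it has the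
form `f(t₁, …, C, …, tₙ)`, where the context `C` is the `i`-th argument and all other
arguments are terms (the value of `ts` at `i` is ignored). -/
inductive Context (S : Signature.{u}) (X : Type v) : Type (max u v)
  | hole : Context S X
  | app (f : S.Sym) (i : Fin (S.arity f)) (ts : Fin (S.arity f) → Term S X)
      (C : Context S X) : Context S X

/-- The term `C[s]`. -/
def Context.fill : Context S X → Term S X → Term S X
  | Context.hole, s => s
  | Context.app f i ts C, s => Term.app f (Function.update ts i (C.fill s))

/-- The position of the hole. -/
def Context.pos : Context S X → List ℕ
  | Context.hole => []
  | Context.app _ i _ C => (i : ℕ) :: C.pos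

/-- A rewrite rule `lhs → rhs`. Both sides may be infinite. -/
structure RewriteRule (S : Signature.{u}) (X : Type v) where
  lhs : Term S X
  rhs : Term S X
  lhs_ne_var : ∀ x, lhs ≠ Term.var x
  vars_subset : rhs.vars ⊆ lhs.vars

/-- A term rewriting system: a set of rewrite rules. -/
abbrev TRS (S : Signature.{u}) (X : Type v) := Set (RewriteRule S X)

/-- Binary relations on terms, ordered by inclusion. -/
abbrev Rel (S : Signature.{u}) (X : Type v) := Term S X → Term S X → Prop

/-- A step at position `p` with the pairs of `R` as root steps: `C[u]` becomes `C[v]`, where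
`R u v` and `C` is a context with its hole at `p`. -/
def StepAt (R : Rel S X) (p : List ℕ) : Rel S X := fun s t =>
  ∃ (C : Context S X) (u v : Term S X), C.pos = p ∧ R u v ∧ s = C.fill u ∧ t = C.fill v

/-- The root steps `lσ → rσ` of a term rewriting system. -/
def RootStep (𝓡 : TRS S X) : Rel S X := fun s t =>
  ∃ ρ ∈ 𝓡, ∃ σ : X → Term S X, s = ρ.lhs.subst σ ∧ t = ρ.rhs.subst σ

/-- The rewrite relation `→` of a term rewriting system. -/
def Step (𝓡 : TRS S X) : Rel S X := fun s t =>
  ∃ p, StepAt (RootStep 𝓡) p s t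

/-- The lifting of `R`: all pairs `(f(s₁, …, sₙ), f(t₁, …, tₙ))` with `R sᵢ tᵢ` for all `i`, and
all pairs `(s, s)`. -/
def Lift (R : Rel S X) : Rel S X := fun s t =>
  (∃ (f : S.Sym) (ss ts : Fin (S.arity f) → Term S X),
    s = Term.app f ss ∧ t = Term.app f ts ∧ ∀ i, R (ss i) (ts i)) ∨ s = t

/-- The operator `R ↦ (← ∪ → ∪ lift R)*`, where the arrows are root steps. -/
def eqInfOp (𝓡 : TRS S X) : Rel S X →o Rel S X where
  toFun R := Relation.ReflTransGen
    (fun s t => RootStep 𝓡 t s ∨ RootStep 𝓡 s t ∨ Lift R s t)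
  monotone' := by
    intro R R' h s t hst
    refine Relation.ReflTransGen.mono ?_ _ _ hst
    rintro a b (hab | hab | ⟨f, ss, ts, h1, h2, h3⟩ | hab)
    · exact Or.inl hab
    · exact Or.inr (Or.inl hab)
    · exact Or.inr (Or.inr (Or.inl ⟨f, ss, ts, h1, h2, fun i => h _ _ (h3 i)⟩))
    · exact Or.inr (Or.inr (Or.inr hab))

/-- Infinitary equational reasoning: the greatest fixed point of the operator above. -/
def EqInf (𝓡 : TRS S X) : Rel S X := (eqInfOp 𝓡).gfp

/-- The strongly convergent rewrite relation obtained from the single steps `R`: `s` and `t` are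
the first and the last term of a sequence `τ` of steps, of some ordinal length `α`, such that at
every limit ordinal `l ≤ α` the distance of `τ β` and `τ l` tends to `0`, and the depth of the
steps tends to infinity, as `β` approaches `l` from below. -/
def StrongConv (R : Rel S X) : Rel S X := fun s t =>
  ∃ (α : Ordinal.{w}) (τ : Ordinal.{w} → Term S X) (p : Ordinal.{w} → List ℕ),
    τ 0 = s ∧ τ α = t ∧
    (∀ β < α, StepAt R (p β) (τ β) (τ (Order.succ β))) ∧
    ∀ l ≤ α, Order.IsSuccLimit l →
      (∀ ε : ℝ, 0 < ε → ∃ γ < l, ∀ β, γ ≤ β → β < l → Term.dist (τ β) (τ l) < ε) ∧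
      (∀ n : ℕ, ∃ γ < l, ∀ β, γ ≤ β → β < l → n ≤ (p β).length)

/-- The operator `x ↦ R ∪ S(E(x))`, where `E` is the equivalence closure and `S` the strongly
convergent rewrite relation. -/
def kahrsOp (R : Rel S X) : Rel S X →o Rel S X where
  toFun x := fun s t => R s t ∨ StrongConv.{u, v, w} (Relation.EqvGen x) s t
  monotone' := by
    rintro x y h s t (hst | ⟨α, τ, p, h1, h2, h3, h4⟩)
    · exact Or.inl hst
    · refine Or.inr ⟨α, τ, p, h1, h2, fun β hβ => ?_, h4⟩
      obtain ⟨C, a, b, hC, hab, ha, hb⟩ := h3 β hβ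
      exact ⟨C, a, b, hC, Relation.EqvGen.mono h _ _ hab, ha, hb⟩

/-- The closure `(S ∘ E)⋆(R)`: the least fixed point of the operator above. -/
def KahrsClosure (R : Rel S X) : Rel S X := (kahrsOp.{u, v, w} R).lfp

end InfRew

namespace InfRew

variable {S : Signature.{u}} {X : Type v}

/-! By least fixed point induction it suffices that `EqInf` contains the rewrite steps and absorbs
both equivalence closure and strong convergence. The first two follow from the fixed point equation,
with coinduction for symmetry. For strong convergence (`SegmentRel.eqInf`), coinduction is applied
to the ends of all strongly convergent sequences of `EqInf`-steps. Before a limit there is a tail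
without root steps; it keeps the root symbol and induces on each argument a strongly convergent
sequence whose depths are one less. Well-founded induction on the end of the sequence
(`IsSegment.reflTransGen`) thus yields a finite chain of `EqInf`-links and lifted sequences. -/

/-- The `i`-th argument of a term, or the term itself if there is none. -/
def Term.child (i : ℕ) (t : Term S X) : Term S X :=
  match PFunctor.M.dest t with
  | ⟨Sum.inl _, _⟩ => t
  | ⟨Sum.inr f, ts⟩ => if h : i < S.arity f then ts ⟨i, h⟩ else t

theorem Term.exists_var_or_app (t : Term S X) :
    (∃ x, t = Term.var x) ∨ ∃ f ts, t = Term.app f ts := by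
  rw [← PFunctor.M.mk_dest t]
  rcases PFunctor.M.dest t with ⟨x | f, ts⟩
  · refine Or.inl ⟨x, ?_⟩
    unfold Term.var
    congr 2
    funext e
    exact e.elim
  · exact Or.inr ⟨f, ts, rfl⟩

theorem Term.dest_var (x : X) :
    PFunctor.M.dest (Term.var x : Term S X) = ⟨Sum.inl x, Empty.elim⟩ :=
  PFunctor.M.dest_mk _

theorem Term.dest_app (f : S.Sym) (ts : Fin (S.arity f) → Term S X) :
    PFunctor.M.dest (Term.app f ts) = ⟨Sum.inr f, ts⟩ :=
  PFunctor.M.dest_mk _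

@[simp] theorem Term.head_var (x : X) : (Term.var x : Term S X).head = Sum.inl x := by
  rw [Term.head, Term.dest_var]

@[simp] theorem Term.head_app (f : S.Sym) (ts : Fin (S.arity f) → Term S X) :
    (Term.app f ts).head = Sum.inr f := by
  rw [Term.head, Term.dest_app]

theorem Term.child_app (i : ℕ) (f : S.Sym) (ts : Fin (S.arity f) → Term S X) :
    (Term.app f ts).child i = if h : i < S.arity f then ts ⟨i, h⟩ else Term.app f ts := by
  rw [Term.child, Term.dest_app]

theorem Term.subtermAt_app_cons (i : ℕ) (p : List ℕ) (f : S.Sym)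
    (ts : Fin (S.arity f) → Term S X) :
    (Term.app f ts).subtermAt (i :: p) =
      if h : i < S.arity f then (ts ⟨i, h⟩).subtermAt p else none := by
  rw [Term.subtermAt, Term.dest_app]

theorem lift_of_head_eq {R : Rel S X} {s t : Term S X} (hd : s.head = t.head)
    (h : ∀ i, R (s.child i) (t.child i)) : Lift R s t := by
  rcases s.exists_var_or_app with ⟨x, rfl⟩ | ⟨f, ss, rfl⟩ <;>
  rcases t.exists_var_or_app with ⟨y, rfl⟩ | ⟨g, ts, rfl⟩ <;> simp at hd
  · exact Or.inr (by rw [hd])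
  · subst hd
    refine Or.inl ⟨f, ss, ts, rfl, rfl, fun i => ?_⟩
    simpa [Term.child_app] using h i

theorem Lift.child {R : Rel S X} (hR : ∀ t, R t t) (hL : ∀ s t, Lift R s t → R s t)
    {s t : Term S X} (h : Lift R s t) (i : ℕ) : R (s.child i) (t.child i) := by
  rcases id h with ⟨f, ss, ts, rfl, rfl, h'⟩ | rfl
  · rw [Term.child_app, Term.child_app]
    split_ifs
    · exact h' _
    · exact hL _ _ h
  · exact hR _

theorem Lift.mono {R R' : Rel S X} (h : ∀ s t, R s t → R' s t) {s t : Term S X}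
    (hst : Lift R s t) : Lift R' s t := by
  rcases hst with ⟨f, ss, ts, h1, h2, h3⟩ | h1
  · exact Or.inl ⟨f, ss, ts, h1, h2, fun i => h _ _ (h3 i)⟩
  · exact Or.inr h1

/-! ### Agreement up to a level, and the metric -/

/-- The labelled trees `s` and `t` coincide at all levels below `n`. -/
def AgreeBelow : ℕ → Rel S X
  | 0 => fun _ _ => True
  | n + 1 => fun s t => s.head = t.head ∧ ∀ i, AgreeBelow n (s.child i) (t.child i)

theorem AgreeBelow.refl (n : ℕ) (t : Term S X) : AgreeBelow n t t := by
  induction n generalizing t with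
  | zero => trivial
  | succ n ih => exact ⟨rfl, fun i => ih _⟩

theorem exists_differsAtLevel_of_not_agreeBelow {n : ℕ} {s t : Term S X}
    (h : ¬ AgreeBelow n s t) : ∃ k < n, Term.DiffersAtLevel s t k := by
  induction n generalizing s t with
  | zero => exact absurd trivial h
  | succ n ih =>
    by_cases hd : s.head = t.head
    · obtain ⟨i, hi⟩ : ∃ i, ¬ AgreeBelow n (s.child i) (t.child i) := by
        by_contra! hc
        exact h ⟨hd, hc⟩
      obtain ⟨k, hk, hdiff⟩ := ih hi
      rcases s.exists_var_or_app with ⟨x, rfl⟩ | ⟨f, ss, rfl⟩ <;>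
      rcases t.exists_var_or_app with ⟨y, rfl⟩ | ⟨g, ts, rfl⟩ <;> simp at hd
      · subst hd
        exact absurd (AgreeBelow.refl _ _) h
      · subst hd
        rw [Term.child_app, Term.child_app] at hdiff
        split_ifs at hdiff with hlt
        · obtain ⟨p, hp, hne⟩ := hdiff
          refine ⟨k + 1, by omega, i :: p, by simp [hp], ?_⟩
          simpa [Term.subtermAt_app_cons, hlt] using hne
        -- Here `i` is out of range, so `child` returned the terms themselves and the level is not
        -- shifted.
        · exact ⟨k, by omega, hdiff⟩
    · exact ⟨0, by omega, [], rfl, by simpa [Term.subtermAt] using hd⟩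

theorem agreeBelow_of_dist_lt {n : ℕ} {s t : Term S X} (h : Term.dist s t < (2⁻¹ : ℝ) ^ n) :
    AgreeBelow n s t := by
  by_contra hc
  obtain ⟨k, hk, hdiff⟩ := exists_differsAtLevel_of_not_agreeBelow hc
  have hne : s ≠ t := by
    rintro rfl
    exact hc (AgreeBelow.refl _ _)
  rw [Term.dist, if_neg hne] at h
  refine absurd h (not_lt.2 ?_)
  exact pow_le_pow_of_le_one (by norm_num) (by norm_num)
    ((Nat.sInf_le (show k ∈ {n | Term.DiffersAtLevel s t n} from hdiff)).trans hk.le)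

/-! ### Closure properties of infinitary equality -/

section EqInf

variable (𝓡 : TRS S X)

theorem eqInfOp_eqInf : eqInfOp 𝓡 (EqInf 𝓡) = EqInf 𝓡 :=
  OrderHom.map_gfp _

theorem EqInf.refl (t : Term S X) : EqInf 𝓡 t t := by
  rw [← eqInfOp_eqInf]
  exact Relation.ReflTransGen.refl

variable {𝓡}

theorem EqInf.trans {s t r : Term S X} (h : EqInf 𝓡 s t) (h' : EqInf 𝓡 t r) :
    EqInf 𝓡 s r := by
  rw [← eqInfOp_eqInf] at *
  exact Relation.ReflTransGen.trans h h'

theorem EqInf.of_rootStep {s t : Term S X} (h : RootStep 𝓡 s t) : EqInf 𝓡 s t := by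
  rw [← eqInfOp_eqInf]
  exact Relation.ReflTransGen.single (Or.inr (Or.inl h))

theorem EqInf.of_lift {s t : Term S X} (h : Lift (EqInf 𝓡) s t) : EqInf 𝓡 s t := by
  rw [← eqInfOp_eqInf]
  exact Relation.ReflTransGen.single (Or.inr (Or.inr h))

/-- Coinduction: the generating relation is invariant under converse, so the converse of `EqInf` is
a post-fixed point. -/
theorem EqInf.symm {s t : Term S X} (h : EqInf 𝓡 s t) : EqInf 𝓡 t s := by
  have key : (fun a b => EqInf 𝓡 b a) ≤ EqInf 𝓡 := by
    refine OrderHom.le_gfp _ ?_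
    intro a b hab
    rw [← eqInfOp_eqInf] at hab
    refine Relation.ReflTransGen.mono ?_ _ _ (Relation.ReflTransGen.swap _ _ hab)
    rintro c d (hcd | hcd | ⟨f, ss, ts, h1, h2, h3⟩ | hcd)
    · exact Or.inr (Or.inl hcd)
    · exact Or.inl hcd
    · exact Or.inr (Or.inr (Or.inl ⟨f, ts, ss, h2, h1, h3⟩))
    · exact Or.inr (Or.inr (Or.inr hcd.symm))
  exact key t s h

theorem EqInf.of_eqvGen {s t : Term S X} (h : Relation.EqvGen (EqInf 𝓡) s t) :
    EqInf 𝓡 s t := by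
  induction h with
  | rel _ _ h => exact h
  | refl _ => exact EqInf.refl _ _
  | symm _ _ _ ih => exact ih.symm
  | trans _ _ _ _ _ ih ih' => exact ih.trans ih'

/-! ### Steps below a given depth -/

variable (𝓡) in
/-- Infinitary equality applied below depth `n` only. -/
def DeepEq : ℕ → Rel S X
  | 0 => EqInf 𝓡
  | n + 1 => Lift (DeepEq n)

theorem DeepEq.refl (n : ℕ) (t : Term S X) : DeepEq 𝓡 n t t := by
  cases n with
  | zero => exact EqInf.refl _ _
  | succ n => exact Or.inr rfl

theorem DeepEq.of_succ {n : ℕ} {s t : Term S X} (h : DeepEq 𝓡 (n + 1) s t) :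
    DeepEq 𝓡 n s t := by
  induction n generalizing s t with
  | zero => exact EqInf.of_lift h
  | succ n ih => exact Lift.mono (fun _ _ => ih) h

theorem DeepEq.eqInf {n : ℕ} {s t : Term S X} (h : DeepEq 𝓡 n s t) : EqInf 𝓡 s t := by
  induction n with
  | zero => exact h
  | succ n ih => exact ih h.of_succ

theorem DeepEq.child {n : ℕ} {s t : Term S X} (h : DeepEq 𝓡 (n + 1) s t) (i : ℕ) :
    DeepEq 𝓡 n (s.child i) (t.child i) :=
  Lift.child (DeepEq.refl n) (fun _ _ => DeepEq.of_succ) h i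

theorem DeepEq.fill {u v : Term S X} (h : EqInf 𝓡 u v) (C : Context S X) :
    DeepEq 𝓡 C.pos.length (C.fill u) (C.fill v) := by
  induction C with
  | hole => exact h
  | app f i ts C ih =>
    refine Or.inl ⟨f, _, _, rfl, rfl, fun j => ?_⟩
    by_cases hj : j = i
    · subst hj
      simpa using ih
    · simpa [hj] using DeepEq.refl _ _

theorem DeepEq.of_stepAt {p : List ℕ} {s t : Term S X} (h : StepAt (EqInf 𝓡) p s t) :
    DeepEq 𝓡 p.length s t := by
  obtain ⟨C, u, v, rfl, huv, rfl, rfl⟩ := h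
  exact DeepEq.fill huv C

theorem EqInf.of_step {s t : Term S X} (h : Step 𝓡 s t) : EqInf 𝓡 s t := by
  obtain ⟨_, C, u, v, _, huv, rfl, rfl⟩ := h
  exact (DeepEq.fill (EqInf.of_rootStep huv) C).eqInf

/-! ### Strongly convergent sequences of infinitary equalities -/

variable (𝓡) in
/-- Between `γ` and `β`, the terms `τ δ` form a strongly convergent sequence in which the `δ`-th
step is an infinitary equality below depth `d δ`. -/
structure IsSegment (τ : Ordinal.{w} → Term S X) (d : Ordinal.{w} → ℕ) (γ β : Ordinal.{w}) :
    Prop where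
  le : γ ≤ β
  step : ∀ δ, γ ≤ δ → δ < β → DeepEq 𝓡 (d δ) (τ δ) (τ (Order.succ δ))
  limit : ∀ l, γ < l → l ≤ β → Order.IsSuccLimit l → ∀ n : ℕ, ∃ δ < l, ∀ ε, δ ≤ ε → ε < l →
    n ≤ d ε ∧ AgreeBelow n (τ ε) (τ l)

theorem IsSegment.subsegment {τ : Ordinal.{w} → Term S X} {d : Ordinal.{w} → ℕ}
    {γ β γ' β' : Ordinal.{w}} (h : IsSegment 𝓡 τ d γ β) (h₁ : γ ≤ γ') (h₂ : γ' ≤ β')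
    (h₃ : β' ≤ β) : IsSegment 𝓡 τ d γ' β' where
  le := h₂
  step δ hδ hδ' := h.step δ (h₁.trans hδ) (hδ'.trans_le h₃)
  limit l hl hl' := h.limit l (h₁.trans_lt hl) (hl'.trans h₃)

/-- A step inside one argument leaves the others unchanged. As `DeepEq` is reflexive at every depth,
all arguments can keep the same ordinal indexing, and only depths, not positions, need to be
recorded. -/
theorem IsSegment.child {τ : Ordinal.{w} → Term S X} {d : Ordinal.{w} → ℕ}
    {γ β : Ordinal.{w}} (h : IsSegment 𝓡 τ d γ β) (hd : ∀ δ, γ ≤ δ → δ < β → 1 ≤ d δ) (i : ℕ) :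
    IsSegment 𝓡 (fun δ => (τ δ).child i) (fun δ => d δ - 1) γ β where
  le := h.le
  step δ hδ hδ' := by
    have h1 := h.step δ hδ hδ'
    rw [← Nat.sub_add_cancel (hd δ hδ hδ')] at h1
    exact h1.child i
  limit l hl hl' hlim n := by
    obtain ⟨δ, hδ, hδ'⟩ := h.limit l hl hl' hlim (n + 1)
    refine ⟨δ, hδ, fun ε hε hε' => ?_⟩
    obtain ⟨h1, h2⟩ := hδ' ε hε hε'
    exact ⟨by omega, h2.2 i⟩

variable (𝓡) in
/-- The first and the last term of a strongly convergent sequence of infinitary equalities. -/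
def SegmentRel : Rel S X := fun s t =>
  ∃ (τ : Ordinal.{w} → Term S X) (d : Ordinal.{w} → ℕ) (γ β : Ordinal.{w}),
    IsSegment 𝓡 τ d γ β ∧ τ γ = s ∧ τ β = t

/-- A strongly convergent sequence has finitely many root steps, and the sequences between them
act on the arguments. -/
theorem IsSegment.reflTransGen {τ : Ordinal.{w} → Term S X} {d : Ordinal.{w} → ℕ}
    {γ β : Ordinal.{w}} (h : IsSegment 𝓡 τ d γ β) :
    Relation.ReflTransGen (fun s t => EqInf 𝓡 s t ∨ Lift (SegmentRel.{u, v, w} 𝓡) s t)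
      (τ γ) (τ β) := by
  induction β using WellFoundedLT.induction with
  | ind β ih =>
  rcases h.le.eq_or_lt with rfl | hlt
  · exact Relation.ReflTransGen.refl
  rcases Ordinal.zero_or_succ_or_isSuccLimit β with rfl | ⟨β', rfl⟩ | hlim
  · exact absurd hlt (not_lt.2 zero_le)
  · have hβ : β' < Order.succ β' := Order.lt_succ β'
    have hγ : γ ≤ β' := Order.lt_succ_iff.1 hlt
    exact (ih β' hβ (h.subsegment le_rfl hγ hβ.le)).tail
      (Or.inl (h.step β' hγ hβ).eqInf)
  -- Level `1` suffices: from `δ` on, all steps are below the root and the root symbol is that of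
  -- the limit.
  · obtain ⟨δ, hδ, hδ'⟩ := h.limit β hlt le_rfl hlim 1
    have hm : max γ δ < β := max_lt hlt hδ
    have hd : ∀ ε, max γ δ ≤ ε → ε < β → 1 ≤ d ε := fun ε hε hε' =>
      (hδ' ε ((le_max_right _ _).trans hε) hε').1
    refine (ih _ hm (h.subsegment le_rfl (le_max_left _ _) hm.le)).tail (Or.inr ?_)
    exact lift_of_head_eq (hδ' _ (le_max_right _ _) hm).2.1 fun i =>
      ⟨fun ε => (τ ε).child i, _, _, _,
        (h.subsegment (le_max_left _ _) hm.le le_rfl).child hd i, rfl, rfl⟩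

theorem SegmentRel.eqInf {s t : Term S X} (h : SegmentRel.{u, v, w} 𝓡 s t) :
    EqInf 𝓡 s t := by
  -- `EqInf` is joined in because the chains also contain `EqInf`-links, which must unfold within
  -- the same candidate.
  have key : SegmentRel.{u, v, w} 𝓡 ⊔ EqInf 𝓡 ≤ EqInf 𝓡 := by
    refine OrderHom.le_gfp _ ?_
    have hle : EqInf 𝓡 ≤ eqInfOp 𝓡 (SegmentRel.{u, v, w} 𝓡 ⊔ EqInf 𝓡) :=
      (eqInfOp_eqInf 𝓡).ge.trans ((eqInfOp 𝓡).monotone le_sup_right)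
    refine sup_le ?_ hle
    rintro a b ⟨τ, d, γ, β, hseg, rfl, rfl⟩
    have hchain := hseg.reflTransGen
    generalize τ γ = a, τ β = b at hchain
    induction hchain with
    | refl => exact Relation.ReflTransGen.refl
    | tail _ hbc ih =>
    refine Relation.ReflTransGen.trans ih ?_
    rcases hbc with hbc | hbc
    · exact hle _ _ hbc
    · exact Relation.ReflTransGen.single
        (Or.inr (Or.inr (Lift.mono (fun _ _ h => Or.inl h) hbc)))
  exact key s t (Or.inl h)

theorem EqInf.of_strongConv {s t : Term S X} (h : StrongConv.{u, v, w} (EqInf 𝓡) s t) :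
    EqInf 𝓡 s t := by
  obtain ⟨α, τ, p, rfl, rfl, hstep, hlim⟩ := h
  refine SegmentRel.eqInf.{u, v, w} ⟨τ, fun δ => (p δ).length, 0, α, ⟨zero_le, ?_, ?_⟩, rfl, rfl⟩
  · exact fun δ _ hδ => DeepEq.of_stepAt (hstep δ hδ)
  · intro l _ hl hl' n
    obtain ⟨hdist, hdepth⟩ := hlim l hl hl'
    obtain ⟨γ₁, hγ₁, h₁⟩ := hdist ((2⁻¹ : ℝ) ^ n) (by positivity)
    obtain ⟨γ₂, hγ₂, h₂⟩ := hdepth n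
    exact ⟨max γ₁ γ₂, max_lt hγ₁ hγ₂, fun ε hε hε' =>
      ⟨h₂ ε ((le_max_right _ _).trans hε) hε',
        agreeBelow_of_dist_lt (h₁ ε ((le_max_left _ _).trans hε) hε')⟩⟩

end EqInf

end InfRew

theorem mainTheorem9 (S : Signature.{u}) (X : Type v) (𝓡 : InfRew.TRS S X)
    (s t : InfRew.Term S X) (h : InfRew.KahrsClosure.{u, v, w} (InfRew.Step 𝓡) s t) :
    InfRew.EqInf 𝓡 s t := by
  have key : InfRew.KahrsClosure.{u, v, w} (InfRew.Step 𝓡) ≤ InfRew.EqInf 𝓡 := by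
    refine OrderHom.lfp_le _ ?_
    rintro a b (hab | ⟨α, τ, p, h1, h2, h3, h4⟩)
    · exact InfRew.EqInf.of_step hab
    · refine InfRew.EqInf.of_strongConv.{u, v, w} ⟨α, τ, p, h1, h2, fun β hβ => ?_, h4⟩
      obtain ⟨C, x, y, hC, hxy, hx, hy⟩ := h3 β hβ
      exact ⟨C, x, y, hC, InfRew.EqInf.of_eqvGen hxy, hx, hy⟩
  exact key s t h
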